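/- Let $p$ be a prime, $l,h$ positive integers with $h\mid l$, $q=p^l$, and regard $\mathbb F_{p^h}$ as a subfield of $\mathbb F_q$. Assume $p^h\ge 4$ if $p=2$, $p^h\ge 5$ if $p$ is odd, and $p^h+1\mid q-1$. Let $m\ge 3$ and let $S_1,S_2\subseteq\{1,\dots,m-1\}$ satisfy $S_1\cup S_2=\{1,\dots,m-1\}$ and $S_1\cap S_2=\emptyset$. Conventions: a linear code $C\subseteq\mathbb F_{p^h}^n$ has parameters $[n,k,d]_{p^h}$ if $k=\dim C$ and $d$ is its minimum distance (the least Hamming weight of a nonzero codeword). It is an $(r,\delta)$-LRC if every coordinate $i\in\{1,\dots,n\}$ lies in some $\overline R\subseteq\{1,\dots,n\}$ with $\#\overline R\le r+\delta-1$ such that the projection $C[\overline R]$ of $C$ onto the coordinates in $\overline R$ has minimum distance at least $\delta$ (in particular $C[\overline R]\neq 0$). It is an optimal $(r,\delta)$-LRC if moreover $k+d+\left(\lceil k/r\rceil-1\right)(\delta-1)=n+1$. (A) Let $z,t$ be integers with $0\le t<z\le\lfloor p^h/2\rfloor-1$ and $2t\ge\max\{0,4z-p^h-1\}$. Let $n_1,\dots,n_{m-1}$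 be positive integers and $a$ an integer such that one of the following holds: 1. $n_j\mid q-1$ for all $j\in S_1$, $n_j-1\mid q-1$ for all $j\in S_2$, and $a=0$; 2. $S_1=\emptyset$, $n_j-1\mid q-1$ for all $j\in S_2$, $a=2(z-t)$ and, if $p$ is odd, $\gcd(n_1\cdots n_{m-1},p^h)\ne1$ or $\gcd(n_1\cdots n_{m-1},p^h+1)\neq 1$. Then there exists an optimal $(r,\delta)$-LRC over $\mathbb F_{p^h}$ with $(r,\delta)=(2z+1,\,p^h-2z+1)$ and parameters $$[n,k,d]_{p^h}=\left[(p^h+1)n_1\cdots n_{m-1},\ (2z+1)n_1\cdots n_{m-1}-a,\ p^h+1-2z+a\right]_{p^h}.$$ (B) Assume $p=2$ and let $u$ be an integer with $0\le u\le \frac{p^h}{2}-2$. Let $n_1,\dots,n_{m-1}$ be positive integers and $a$ an integer such that one of the following holds: 1. $n_j\mid q-1$ for all $j\in S_1$, $n_j-1\mid q-1$ for all $j\in S_2$, and $a=0$; 2. $S_1=\emptyset$, $n_j-1\mid q-1$ for all $j\in S_2$, and $a=2(u-v)$ for some integer $v$ with $0\le v<u$ and $2v+1\ge\max\{0,4u+1-p^h\}$.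 Then there exists an optimal $(r,\delta)$-LRC over $\mathbb F_{p^h}$ with $(r,\delta)=(2u+2,\,p^h-2u)$ and parameters $$[n,k,d]_{p^h}=\left[(p^h+1)n_1\cdots n_{m-1},\ (2u+2)n_1\cdots n_{m-1}-a,\ p^h-2u+a\right]_{p^h}.$$ -/

import Mathlib

namespace LRC

/-- `d` is the minimum distance of the linear code `C`: the least Hamming weight of a nonzero
codeword. (The zero code has no minimum distance.) -/
def HasMinDist {K ι : Type*} [Field K] [Fintype ι] (C : Submodule K (ι → K)) (d : ℕ) : Prop :=
  open Classical in IsLeast {w : ℕ | ∃ c ∈ C, c ≠ 0 ∧ hammingNorm c = w} d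

/-- The projection `C[R]` of the code `C` on the coordinates in `R`. -/
def proj {K ι : Type*} [Field K] (C : Submodule K (ι → K)) (R : Finset ι) :
    Submodule K (R → K) :=
  C.map (LinearMap.funLeft K K (fun i : R => (i : ι)))

/-- `C` is an `(r, δ)`-LRC: every coordinate `i` lies in a set `R` of at most `r + δ - 1`
coordinates such that the projection `C[R]` has minimum distance at least `δ`. -/
def IsLRC {K ι : Type*} [Field K] [Fintype ι] (C : Submodule K (ι → K)) (r δ : ℕ) : Prop :=
  ∀ i : ι, ∃ R : Finset ι, i ∈ R ∧ R.card ≤ r + δ - 1 ∧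
    ∃ e : ℕ, HasMinDist (proj C R) e ∧ δ ≤ e

/-- `C` is a linear code with parameters `[n, k, d]` over `K`. -/
def HasParams {K : Type*} [Field K] {n : ℕ} (C : Submodule K (Fin n → K)) (k d : ℕ) : Prop :=
  Module.finrank K C = k ∧ HasMinDist C d

/-- `C` is an optimal `(r, δ)`-LRC: it is an `(r, δ)`-LRC whose parameters `[n, k, d]` attain
equality in the Singleton-like bound `k + d + (⌈k / r⌉ - 1) (δ - 1) ≤ n + 1`. -/
def IsOptimalLRC {K : Type*} [Field K] {n : ℕ} (C : Submodule K (Fin n → K)) (r δ : ℕ) : Prop :=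
  IsLRC C r δ ∧ ∃ k d : ℕ, HasParams C k d ∧
    (k : ℤ) + d + (⌈(k : ℚ) / r⌉ - 1) * ((δ : ℤ) - 1) = n + 1

end LRC

namespace LRC

/-! Put `Q = p ^ h` and `N = ∏ n_j`. Let `A` be the evaluation code of the forms of degree `D` on
the `Q + 1` points of the projective line: it is MDS, with dimension `D + 1` and distance `Q + 1 -
D`. A form `w` of degree `2s` without rational zeros turns the forms of degree `D - 2s` into a
subcode `B` of `A`, of dimension `D - 2s + 1` and distance `Q + 1 - D + 2s`.

The code consists of `N` blocks from `A` whose sum lies in `B`. This imposes `2s` conditions, so `k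
= (D + 1)N - 2s`. A word with one nonzero block has that block in `B`; any other nonzero word weighs
at least `2(Q + 1 - D)`. Hence `d = Q + 1 - D + 2s` as soon as `D + 2s ≤ Q + 1`. The blocks are the
recovery sets, with `r = D + 1` and `δ = Q + 1 - D`. Since `2s < r`, `⌈k / r⌉ = N`, and equality in
the Singleton-like bound follows.

Part (A) is `D = 2z`, part (B) is `D = 2u + 1`, with `a = 2s`; the divisibility conditions give `N >
0`. -/

open Polynomial Module

/-! ### Gluing blocks of a code along a condition on their sum -/

section Gluing

variable {K ι κ σ : Type*} [Field K]

/-- The word on `σ ≃ κ × ι` whose blocks are the given words of `A`. -/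
def concat (A : Submodule K (ι → K)) (e : σ ≃ κ × ι) : (κ → A) →ₗ[K] (σ → K) where
  toFun f := fun s => (f (e s).1 : ι → K) (e s).2
  map_add' _ _ := rfl
  map_smul' _ _ := rfl

theorem concat_apply_symm (A : Submodule K (ι → K)) (e : σ ≃ κ × ι) (f : κ → A) (j : κ) (i : ι) :
    concat A e f (e.symm (j, i)) = (f j : ι → K) i := by
  simp [concat]

theorem concat_injective (A : Submodule K (ι → K)) (e : σ ≃ κ × ι) :
    Function.Injective (concat A e) := by
  intro f g hfg
  funext j
  ext i
  rw [← concat_apply_symm A e f, hfg, concat_apply_symm]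

/-- The class modulo `B` of the sum of a family of words of `A`. -/
def sumMod [Fintype κ] (A B : Submodule K (ι → K)) :
    (κ → A) →ₗ[K] (A ⧸ B.comap A.subtype) :=
  (B.comap A.subtype).mkQ ∘ₗ ∑ j : κ, LinearMap.proj j

theorem mem_ker_sumMod [Fintype κ] {A B : Submodule K (ι → K)} {f : κ → A} :
    f ∈ LinearMap.ker (sumMod A B) ↔ ∑ j, (f j : ι → K) ∈ B := by
  rw [LinearMap.mem_ker, sumMod, LinearMap.comp_apply, Submodule.mkQ_apply,
    Submodule.Quotient.mk_eq_zero]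
  simp

theorem sumMod_surjective [Fintype κ] [Nonempty κ] (A B : Submodule K (ι → K)) :
    Function.Surjective (sumMod (κ := κ) A B) := by
  classical
  intro y
  obtain ⟨x, rfl⟩ := Submodule.mkQ_surjective _ y
  refine ⟨Pi.single (Classical.arbitrary κ) x, ?_⟩
  simp [sumMod]

/-- The code of all words whose blocks lie in `A` and sum up to a word of `B`. -/
def gluedCode [Fintype κ] (A B : Submodule K (ι → K)) (e : σ ≃ κ × ι) : Submodule K (σ → K) :=
  (LinearMap.ker (sumMod A B)).map (concat A e)

/-- Rank-nullity for the surjection `sumMod`, whose target has dimension `dim A - dim B`; the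
additive form avoids truncated subtraction. -/
theorem finrank_gluedCode [Fintype κ] [Nonempty κ] [Fintype ι] {A B : Submodule K (ι → K)}
    (hBA : B ≤ A) (e : σ ≃ κ × ι) :
    finrank K (gluedCode A B e) + finrank K A = Fintype.card κ * finrank K A + finrank K B := by
  have h1 : finrank K (gluedCode A B e) = finrank K (LinearMap.ker (sumMod (κ := κ) A B)) :=
    (Submodule.equivMapOfInjective _ (concat_injective A e) _).finrank_eq.symm
  have h2 := LinearMap.finrank_range_add_finrank_ker (sumMod (κ := κ) A B)
  rw [LinearMap.range_eq_top.2 (sumMod_surjective A B), finrank_top] at h2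
  have h3 := (B.comap A.subtype).finrank_quotient_add_finrank
  have h4 := (Submodule.comapSubtypeEquivOfLe hBA).finrank_eq
  have h5 : finrank K (κ → A) = Fintype.card κ * finrank K A := by
    rw [Module.finrank_pi_fintype]; simp
  omega

open Classical in
theorem hammingNorm_concat [Fintype κ] [Fintype ι] [Fintype σ] (A : Submodule K (ι → K))
    (e : σ ≃ κ × ι) (f : κ → A) :
    hammingNorm (concat A e f) = ∑ j, hammingNorm (f j : ι → K) := by
  simp only [hammingNorm, Finset.card_filter]
  rw [← Equiv.sum_comp e.symm, Fintype.sum_prod_type]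
  simp only [concat_apply_symm]

open Classical in
theorem concat_single [Fintype κ] {A B : Submodule K (ι → K)} (hBA : B ≤ A) (e : σ ≃ κ × ι)
    (j : κ) {b : ι → K} (hb : b ∈ B) :
    concat A e (Pi.single j ⟨b, hBA hb⟩) ∈ gluedCode A B e := by
  refine Submodule.mem_map_of_mem (mem_ker_sumMod.2 ?_)
  rw [← Submodule.coe_sum]
  simpa using hb

theorem hasMinDist_gluedCode [Fintype κ] [Nonempty κ] [Fintype ι] [Fintype σ]
    {A B : Submodule K (ι → K)} (hBA : B ≤ A) (e : σ ≃ κ × ι) {dA dB : ℕ}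
    (hA : HasMinDist A dA) (hB : HasMinDist B dB) (hd : dB ≤ 2 * dA) :
    HasMinDist (gluedCode A B e) dB := by
  classical
  refine ⟨?_, ?_⟩
  · obtain ⟨b, hb, hb0, hw⟩ := hB.1
    refine ⟨_, concat_single hBA e (Classical.arbitrary κ) hb, ?_, ?_⟩
    · intro h0
      rw [← map_zero (concat A e)] at h0
      have := congrArg (fun f : κ → A => (f (Classical.arbitrary κ) : ι → K))
        (concat_injective A e h0)
      simp at this
      exact hb0 this
    · rw [hammingNorm_concat, Finset.sum_eq_single (Classical.arbitrary κ)]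
      · simpa using hw
      · intro j _ hj
        simp [Pi.single_eq_of_ne hj]
      · simp
  · rintro w ⟨_, ⟨f, hf, rfl⟩, hne, rfl⟩
    have hf := mem_ker_sumMod.1 hf
    rw [hammingNorm_concat]
    have hf0 : f ≠ 0 := fun h => hne (by simp [h])
    obtain ⟨j, hj⟩ := Function.ne_iff.1 hf0
    have hj : (f j : ι → K) ≠ 0 := by simpa using hj
    by_cases hone : ∀ j', j' ≠ j → (f j' : ι → K) = 0
    -- The only nonzero block equals the sum of all blocks, so it lies in `B`.
    · rw [Finset.sum_eq_single j (fun j' _ h => hone j' h) (by simp)] at hf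
      refine (hB.2 ⟨_, hf, hj, rfl⟩).trans ?_
      exact Finset.single_le_sum (f := fun j => hammingNorm (f j : ι → K))
        (fun _ _ => Nat.zero_le _) (Finset.mem_univ j)
    -- Two nonzero blocks already contribute `2 * dA ≥ dB`.
    · push Not at hone
      obtain ⟨j', hjj', hj'⟩ := hone
      have h1 : dA ≤ hammingNorm (f j : ι → K) := hA.2 ⟨_, (f j).2, hj, rfl⟩
      have h2 : dA ≤ hammingNorm (f j' : ι → K) := hA.2 ⟨_, (f j').2, hj', rfl⟩
      have h3 : ∑ x ∈ {j, j'}, hammingNorm (f x : ι → K) ≤ ∑ x, hammingNorm (f x : ι → K) :=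
        Finset.sum_le_sum_of_subset (Finset.subset_univ _)
      rw [Finset.sum_pair hjj'.symm] at h3
      omega

theorem HasMinDist.exists_le {R : Type*} [Fintype R] {C : Submodule K (R → K)} {δ : ℕ}
    (hne : ∃ c ∈ C, c ≠ 0)
    (h : open Classical in ∀ c ∈ C, c ≠ 0 → δ ≤ hammingNorm c) :
    ∃ d, HasMinDist C d ∧ δ ≤ d := by
  classical
  let s : Set ℕ := {w | ∃ c ∈ C, c ≠ 0 ∧ hammingNorm c = w}
  have hs : s.Nonempty := let ⟨c, hc, h0⟩ := hne; ⟨_, c, hc, h0, rfl⟩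
  refine ⟨sInf s, ⟨Nat.sInf_mem hs, fun w hw => Nat.sInf_le hw⟩, ?_⟩
  obtain ⟨c, hc, h0, hw⟩ := Nat.sInf_mem hs
  rw [← hw]
  exact h c hc h0

/-- The recovery set of a coordinate is its block: codewords restrict there to words of `A`, and a
nonzero word of `B` placed in that block shows that the projection is nonzero. -/
theorem isLRC_gluedCode [Fintype κ] [Fintype ι] [Fintype σ]
    {A B : Submodule K (ι → K)} (hBA : B ≤ A) (e : σ ≃ κ × ι) {r δ : ℕ}
    (hA : HasMinDist A δ) (hB : ∃ b ∈ B, b ≠ 0) (hcard : Fintype.card ι ≤ r + δ - 1) :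
    IsLRC (gluedCode A B e) r δ := by
  classical
  intro s
  set j := (e s).1 with hj
  let emb : ι ↪ σ := ⟨fun i => e.symm (j, i), fun a b h => by simpa using h⟩
  refine ⟨Finset.univ.map emb, ?_, by simpa using hcard, ?_⟩
  · exact Finset.mem_map.2 ⟨(e s).2, Finset.mem_univ _, by simp [emb, hj]⟩
  have key : ∀ i, emb i ∈ Finset.univ.map emb := fun i =>
    Finset.mem_map_of_mem _ (Finset.mem_univ _)
  apply HasMinDist.exists_le
  · obtain ⟨b, hb, hb0⟩ := hB
    refine ⟨_, Submodule.mem_map_of_mem (concat_single hBA e j hb), fun h0 => hb0 ?_⟩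
    funext i
    have := congrFun h0 ⟨emb i, key i⟩
    rw [LinearMap.funLeft_apply] at this
    change concat A e _ (e.symm (j, i)) = 0 at this
    rw [concat_apply_symm] at this
    simpa using this
  · rintro _ ⟨_, ⟨f, hf, rfl⟩, rfl⟩ hne
    have hval : ∀ i, LinearMap.funLeft K K (fun i : Finset.univ.map emb => (i : σ))
        (concat A e f) ⟨emb i, key i⟩ = (f j : ι → K) i := fun i => concat_apply_symm A e f j i
    have hfj : (f j : ι → K) ≠ 0 := by
      intro h0
      apply hne
      funext ⟨x, hx⟩
      obtain ⟨i, -, rfl⟩ := Finset.mem_map.1 hx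
      rw [hval, h0]
      rfl
    refine (hA.2 ⟨_, (f j).2, hfj, rfl⟩).trans ?_
    refine Finset.card_le_card_of_injOn (fun i => ⟨emb i, key i⟩) ?_ ?_
    · intro i hi
      simp only [Finset.coe_filter, Set.mem_ofPred_eq, Finset.mem_univ, true_and] at hi ⊢
      rwa [hval]
    · intro a _ b _ h
      exact emb.injective (congrArg Subtype.val h)

end Gluing

/-! ### Reed–Solomon codes on the projective line -/

section ProjectiveReedSolomon

variable {K : Type*} [Field K]

/-- Evaluation of a polynomial, seen as a form of degree `D`, on the projective line. -/
def evalProj (K : Type*) [Field K] (D : ℕ) : K[X] →ₗ[K] (Option K → K) where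
  toFun f := fun x => x.elim (f.coeff D) (fun a => f.eval a)
  map_add' f g := by
    funext x
    cases x <;> simp
  map_smul' c f := by
    funext x
    cases x <;> simp

@[simp] theorem evalProj_none (D : ℕ) (f : K[X]) : evalProj K D f none = f.coeff D := rfl

@[simp] theorem evalProj_some (D : ℕ) (f : K[X]) (a : K) :
    evalProj K D f (some a) = f.eval a := rfl

open Classical in
theorem hammingNorm_evalProj [Fintype K] (D : ℕ) (f : K[X]) :
    hammingNorm (evalProj K D f) + (Finset.univ.filter fun a => f.eval a = 0).card =
      Fintype.card K + if f.coeff D = 0 then 0 else 1 := by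
  have h := Finset.card_filter_add_card_filter_not (s := (Finset.univ : Finset K))
    (fun a => f.eval a = 0)
  rw [Finset.card_univ] at h
  have h2 : hammingNorm (evalProj K D f) =
      (if f.coeff D = 0 then 0 else 1) + (Finset.univ.filter fun a => ¬ f.eval a = 0).card := by
    simp only [hammingNorm, Finset.card_filter, Fintype.sum_option, evalProj_none, evalProj_some,
      ne_eq, ite_not]
    congr!
  omega

-- A nonzero form of degree `D` has at most `D` zeros on the projective line: if it vanishes at
-- infinity, the degree of `f` drops below `D`, which makes room for that extra zero.
open Classical in
theorem le_hammingNorm_evalProj [Fintype K] {D : ℕ} {f : K[X]} (hf : f ≠ 0)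
    (hD : f.natDegree ≤ D) :
    Fintype.card K + 1 ≤ hammingNorm (evalProj K D f) + D := by
  have h := hammingNorm_evalProj D f
  have hz : (Finset.univ.filter fun a => f.eval a = 0).card ≤ f.natDegree := by
    refine le_trans (Finset.card_le_card ?_) ((Multiset.toFinset_card_le f.roots).trans
      (card_roots' f))
    intro a ha
    simpa [hf] using ha
  split_ifs at h with h0
  · have : f.natDegree ≠ D := by
      rintro rfl
      exact hf (leadingCoeff_eq_zero.1 h0)
    omega
  · omega

theorem evalProj_injOn [Fintype K] {D : ℕ} (hD : D ≤ Fintype.card K) {f : K[X]}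
    (hf : f.natDegree ≤ D) (h0 : evalProj K D f = 0) : f = 0 := by
  classical
  by_contra hne
  have := le_hammingNorm_evalProj hne hf
  rw [h0, hammingNorm_zero] at this
  omega

open Classical in
theorem exists_hammingNorm_evalProj [Fintype K] {D : ℕ} (hD : D ≤ Fintype.card K) :
    ∃ f : K[X], f ≠ 0 ∧ f.natDegree ≤ D ∧
      hammingNorm (evalProj K D f) = Fintype.card K + 1 - D := by
  obtain ⟨S, -, hS⟩ := Finset.exists_subset_card_eq (s := (Finset.univ : Finset K))
    (n := D) (by rwa [Finset.card_univ])
  have hm : (∏ a ∈ S, (X - C a)).Monic := monic_prod_X_sub_C _ _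
  have hdeg : (∏ a ∈ S, (X - C a)).natDegree = D := by
    rw [natDegree_finsetProd_X_sub_C_eq_card, hS]
  refine ⟨∏ a ∈ S, (X - C a), hm.ne_zero, hdeg.le, ?_⟩
  have h := hammingNorm_evalProj D (∏ a ∈ S, (X - C a))
  have hc : (∏ a ∈ S, (X - C a)).coeff D = 1 := by
    rw [← hdeg]; exact hm
  have hz : (Finset.univ.filter fun a => (∏ b ∈ S, (X - C b)).eval a = 0) = S := by
    ext a
    simp [eval_prod, Finset.prod_eq_zero_iff, sub_eq_zero]
  rw [hz, hS, hc, if_neg one_ne_zero] at h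
  omega

/-- The code on the projective line given by the forms of degree `E` times a fixed form `w` of
degree `D - E`. -/
noncomputable def projRS (E D : ℕ) (w : K[X]) : Submodule K (Option K → K) :=
  (degreeLT K (E + 1)).map (evalProj K D ∘ₗ LinearMap.mulLeft K w)

theorem mem_degreeLT_succ {f : K[X]} {E : ℕ} : f ∈ degreeLT K (E + 1) ↔ f.natDegree ≤ E := by
  rw [mem_degreeLT, degree_lt_iff_coeff_zero, natDegree_le_iff_coeff_eq_zero]
  exact ⟨fun h N hN => h N hN, fun h N hN => h N hN⟩

section Twist

variable {E D : ℕ} {w : K[X]}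

theorem evalProj_mul_eq_zero_iff (hw : w.Monic) (hroot : ∀ a, w.eval a ≠ 0)
    (hdeg : w.natDegree + E = D) {g : K[X]} (hg : g.natDegree ≤ E) (x : Option K) :
    evalProj K D (w * g) x = 0 ↔ evalProj K E g x = 0 := by
  cases x with
  | none =>
    -- At infinity the value is the coefficient of top formal degree, which is multiplicative; `w`
    -- has value 1 there because it is monic.
    subst hdeg
    simp only [evalProj_none]
    rw [coeff_mul_add_eq_of_natDegree_le le_rfl hg, hw.coeff_natDegree, one_mul]
  | some a => simp [hroot a]

open Classical in
theorem hammingNorm_evalProj_mul [Fintype K] (hw : w.Monic) (hroot : ∀ a, w.eval a ≠ 0)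
    (hdeg : w.natDegree + E = D) {g : K[X]} (hg : g.natDegree ≤ E) :
    hammingNorm (evalProj K D (w * g)) = hammingNorm (evalProj K E g) := by
  simp only [hammingNorm, ne_eq, evalProj_mul_eq_zero_iff hw hroot hdeg hg]

theorem finrank_projRS [Fintype K] (hw : w.Monic) (hroot : ∀ a, w.eval a ≠ 0)
    (hdeg : w.natDegree + E = D) (hE : E ≤ Fintype.card K) :
    finrank K (projRS E D w) = E + 1 := by
  rw [projRS, ← LinearMap.range_domRestrict, LinearMap.finrank_range_of_inj,
    (degreeLTEquiv K (E + 1)).finrank_eq, finrank_fin_fun]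
  rw [← LinearMap.ker_eq_bot, LinearMap.ker_eq_bot']
  rintro ⟨g, hg⟩ h0
  have hg := mem_degreeLT_succ.1 hg
  ext1
  refine evalProj_injOn hE hg (funext fun x => ?_)
  exact (evalProj_mul_eq_zero_iff hw hroot hdeg hg x).1 (congrFun h0 x)

theorem hasMinDist_projRS [Fintype K] (hw : w.Monic) (hroot : ∀ a, w.eval a ≠ 0)
    (hdeg : w.natDegree + E = D) (hE : E ≤ Fintype.card K) :
    HasMinDist (projRS E D w) (Fintype.card K + 1 - E) := by
  classical
  refine ⟨?_, ?_⟩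
  · obtain ⟨g, -, hg, hwt⟩ := exists_hammingNorm_evalProj hE
    have heq := hammingNorm_evalProj_mul hw hroot hdeg hg
    refine ⟨_, Submodule.mem_map_of_mem (mem_degreeLT_succ.2 hg), ?_, ?_⟩
    · intro h0
      have h0 : evalProj K D (w * g) = 0 := h0
      rw [h0, hammingNorm_zero] at heq
      omega
    · simpa using heq.trans hwt
  · rintro _ ⟨_, ⟨g, hg, rfl⟩, hne, rfl⟩
    have hg := mem_degreeLT_succ.1 hg
    have hg0 : g ≠ 0 := by
      rintro rfl
      simp at hne
    have h1 := le_hammingNorm_evalProj hg0 hg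
    rw [← hammingNorm_evalProj_mul hw hroot hdeg hg] at h1
    change _ ≤ hammingNorm (evalProj K D (w * g))
    omega

theorem projRS_le (hdeg : w.natDegree + E = D) : projRS E D w ≤ projRS D D 1 := by
  rintro _ ⟨g, hg, rfl⟩
  have hg := mem_degreeLT_succ.1 hg
  refine ⟨w * g, mem_degreeLT_succ.2 ?_, by simp⟩
  exact natDegree_mul_le.trans (by omega)

end Twist

/-- In every characteristic `x ^ 2 + x` takes the same value at `0` and `-1`, so on a finite field
it misses some `c`; then `X ^ 2 + X - c` has no root. -/
theorem exists_quadratic_no_root (K : Type*) [Field K] [Finite K] :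
    ∃ P : K[X], P.Monic ∧ P.natDegree = 2 ∧ ∀ a, P.eval a ≠ 0 := by
  have hni : ¬ Function.Injective (fun x : K => x ^ 2 + x) := fun h =>
    neg_ne_zero.2 (one_ne_zero (α := K)) (h (by ring : (-1 : K) ^ 2 + -1 = 0 ^ 2 + 0))
  rw [Finite.injective_iff_surjective] at hni
  obtain ⟨c, hc⟩ := not_forall.1 hni
  refine ⟨X ^ 2 + X - C c, ?_, ?_, ?_⟩
  · monicity!
  · compute_degree!
  · intro a ha
    exact hc ⟨a, by simpa [sub_eq_zero] using ha⟩

theorem exists_monic_no_root (K : Type*) [Field K] [Finite K] (s : ℕ) :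
    ∃ w : K[X], w.Monic ∧ w.natDegree = 2 * s ∧ ∀ a, w.eval a ≠ 0 := by
  obtain ⟨P, hP, hdeg, hroot⟩ := exists_quadratic_no_root K
  refine ⟨P ^ s, hP.pow s, by rw [hP.natDegree_pow, hdeg, mul_comm], fun a => ?_⟩
  rw [eval_pow]
  exact pow_ne_zero _ (hroot a)

end ProjectiveReedSolomon

/-! ### Optimality and choice of parameters -/

theorem ceil_sub_div {N r a k : ℕ} (har : a < r) (hk : k + a = r * N) :
    ⌈(k : ℚ) / r⌉ = (N : ℤ) := by
  have hr : (0 : ℚ) < r := by exact_mod_cast (Nat.zero_le a).trans_lt har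
  have hk' : (k : ℚ) + a = r * N := by exact_mod_cast hk
  have har' : (a : ℚ) < r := by exact_mod_cast har
  have ha : (0 : ℚ) ≤ a := Nat.cast_nonneg a
  rw [Int.ceil_eq_iff]
  constructor
  · rw [lt_div_iff₀ hr]
    push_cast
    nlinarith
  · rw [div_le_iff₀ hr]
    push_cast
    nlinarith

theorem exists_optimalLRC {K : Type*} [Field K] [Fintype K] {Q D s N : ℕ}
    (hQ : Fintype.card K = Q) (hN : 0 < N) (hD : D ≤ Q) (hsD : 2 * s ≤ D)
    (hs : D + 2 * s ≤ Q + 1) :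
    ∃ C : Submodule K (Fin ((Q + 1) * N) → K),
      HasParams C ((D + 1) * N - 2 * s) (Q + 1 - D + 2 * s) ∧
      IsOptimalLRC C (D + 1) (Q + 1 - D) := by
  obtain ⟨w, hw, hdeg, hroot⟩ := exists_monic_no_root K s
  have hcard : Fintype.card (Option K) = Q + 1 := by rw [Fintype.card_option, hQ]
  have : Nonempty (Fin N) := ⟨⟨0, hN⟩⟩
  let e : Fin ((Q + 1) * N) ≃ Fin N × Option K :=
    Fintype.equivOfCardEq (by simp [hQ, mul_comm])
  have hwE : w.natDegree + (D - 2 * s) = D := by omega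
  have h1E : (1 : K[X]).natDegree + D = D := by simp
  have h1 : ∀ a : K, (1 : K[X]).eval a ≠ 0 := by simp
  have hBA := projRS_le hwE
  have hA := hasMinDist_projRS monic_one h1 h1E (hQ ▸ hD)
  have hB := hasMinDist_projRS hw hroot hwE (by omega)
  have hrank := finrank_gluedCode hBA e
  rw [finrank_projRS monic_one h1 h1E (hQ ▸ hD), finrank_projRS hw hroot hwE (by omega),
    Fintype.card_fin] at hrank
  have hB' : ∃ b ∈ projRS (D - 2 * s) D w, b ≠ 0 :=
    let ⟨b, hb, hb0, _⟩ := hB.1; ⟨b, hb, hb0⟩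
  have hmul : D + 1 ≤ N * (D + 1) := Nat.le_mul_of_pos_left _ hN
  have hparams : HasParams (gluedCode (projRS D D 1) (projRS (D - 2 * s) D w) e)
      ((D + 1) * N - 2 * s) (Q + 1 - D + 2 * s) := by
    refine ⟨?_, ?_⟩
    · rw [mul_comm (D + 1) N]
      omega
    · have hd : Q + 1 - D + 2 * s = Fintype.card K + 1 - (D - 2 * s) := by omega
      rw [hd]
      -- The inequality `dB ≤ 2 * dA` is here exactly `D + 2 * s ≤ Q + 1`.
      exact hasMinDist_gluedCode hBA e hA hB (by omega)
  refine ⟨_, hparams, ?_, _, _, hparams, ?_⟩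
  · rw [hQ] at hA
    exact isLRC_gluedCode hBA e hA hB' (by omega)
  · have hk : (D + 1) * N - 2 * s + 2 * s = (D + 1) * N := by
      rw [mul_comm (D + 1) N]
      omega
    rw [ceil_sub_div (by omega : 2 * s < D + 1) hk]
    have hk' : (((D + 1) * N - 2 * s : ℕ) : ℤ) = (D + 1) * N - 2 * s := by
      have := congrArg (Nat.cast : ℕ → ℤ) hk
      push_cast at this ⊢
      linarith
    have hδ : ((Q + 1 - D : ℕ) : ℤ) = Q + 1 - D := by
      push_cast [Nat.cast_sub (by omega : D ≤ Q + 1)]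
      ring
    rw [hk', Nat.cast_add, hδ]
    push_cast
    ring

end LRC

theorem mainTheorem3 (p l h q m : ℕ) (hp : p.Prime) (hl : 0 < l) (hh : 0 < h) (hhl : h ∣ l)
    (hq : q = p ^ l)
    (K F : Type*) [Field K] [Fintype K] [Field F] [Fintype F] [Algebra K F]
    (hK : Fintype.card K = p ^ h) (hF : Fintype.card F = q)
    (hp2 : p = 2 → 4 ≤ p ^ h) (hpodd : p ≠ 2 → 5 ≤ p ^ h)
    (hdvd : p ^ h + 1 ∣ q - 1) (hm : 3 ≤ m)
    (S₁ S₂ : Finset (Fin (m - 1))) (hunion : S₁ ∪ S₂ = Finset.univ) (hinter : S₁ ∩ S₂ = ∅) :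
    (∀ z t : ℕ, t < z → z ≤ p ^ h / 2 - 1 →
      max 0 (4 * (z : ℤ) - (p : ℤ) ^ h - 1) ≤ 2 * (t : ℤ) →
      ∀ (n : Fin (m - 1) → ℕ) (a : ℕ),
        (((∀ j ∈ S₁, n j ∣ q - 1) ∧ (∀ j ∈ S₂, n j - 1 ∣ q - 1) ∧ a = 0) ∨
          (S₁ = ∅ ∧ (∀ j ∈ S₂, n j - 1 ∣ q - 1) ∧ a = 2 * (z - t) ∧
            (p ≠ 2 → Nat.gcd (∏ j, n j) (p ^ h) ≠ 1 ∨ Nat.gcd (∏ j, n j) (p ^ h + 1) ≠ 1))) →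
        ∃ C : Submodule K (Fin ((p ^ h + 1) * ∏ j, n j) → K),
          LRC.HasParams C ((2 * z + 1) * (∏ j, n j) - a) (p ^ h + 1 - 2 * z + a) ∧
          LRC.IsOptimalLRC C (2 * z + 1) (p ^ h - 2 * z + 1)) ∧
    (p = 2 → ∀ u : ℕ, u ≤ p ^ h / 2 - 2 →
      ∀ (n : Fin (m - 1) → ℕ) (a : ℕ),
        (((∀ j ∈ S₁, n j ∣ q - 1) ∧ (∀ j ∈ S₂, n j - 1 ∣ q - 1) ∧ a = 0) ∨
          (S₁ = ∅ ∧ (∀ j ∈ S₂, n j - 1 ∣ q - 1) ∧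
            ∃ v : ℕ, v < u ∧ max 0 (4 * (u : ℤ) + 1 - (p : ℤ) ^ h) ≤ 2 * (v : ℤ) + 1 ∧
              a = 2 * (u - v))) →
        ∃ C : Submodule K (Fin ((p ^ h + 1) * ∏ j, n j) → K),
          LRC.HasParams C ((2 * u + 2) * (∏ j, n j) - a) (p ^ h - 2 * u + a) ∧
          LRC.IsOptimalLRC C (2 * u + 2) (p ^ h - 2 * u)) := by

  have hq : 0 < q - 1 := by
    have : 1 < Fintype.card F := Fintype.one_lt_card
    omega
  have hQ4 : 4 ≤ p ^ h := by
    by_cases h2 : p = 2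
    · exact hp2 h2
    · exact le_trans (by norm_num) (hpodd h2)
  have hpos₁ : ∀ x, x ∣ q - 1 → 0 < x := fun x hx => Nat.pos_of_dvd_of_pos hx hq
  -- With truncated subtraction, `x = 0` would give `0 ∣ q - 1`, impossible since `q > 1`.
  have hpos₂ : ∀ x, x - 1 ∣ q - 1 → 0 < x := fun x hx => by
    have := hpos₁ _ hx
    omega
  have hprod : ∀ n : Fin (m - 1) → ℕ, (∀ j ∈ S₁, n j ∣ q - 1) → (∀ j ∈ S₂, n j - 1 ∣ q - 1) →
      0 < ∏ j, n j := by
    intro n h1 h2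
    refine Finset.prod_pos fun j _ => ?_
    rcases Finset.mem_union.1 (hunion ▸ Finset.mem_univ j) with hj | hj
    · exact hpos₁ _ (h1 j hj)
    · exact hpos₂ _ (h2 j hj)
  refine ⟨?_, ?_⟩
  · intro z t htz hz hzt n a hcases
    rw [show p ^ h - 2 * z + 1 = p ^ h + 1 - 2 * z by omega]
    -- This is `D + 2 * s ≤ Q + 1` for `D = 2 * z` and `s = z - t`.
    have hzt : 4 * (z : ℤ) - (p ^ h : ℕ) - 1 ≤ 2 * t := by
      push_cast
      exact (le_max_right _ _).trans hzt
    rcases hcases with ⟨h1, h2, rfl⟩ | ⟨rfl, h2, rfl, -⟩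
    · exact LRC.exists_optimalLRC (D := 2 * z) (s := 0) hK (hprod n h1 h2) (by omega) (by omega)
        (by omega)
    · exact LRC.exists_optimalLRC (D := 2 * z) (s := z - t) hK (hprod n (by simp) h2) (by omega)
        (by omega) (by omega)
  · intro _ u hu n a hcases
    rw [show p ^ h - 2 * u = p ^ h + 1 - (2 * u + 1) by omega]
    rcases hcases with ⟨h1, h2, rfl⟩ | ⟨rfl, h2, v, hvu, huv, rfl⟩
    · exact LRC.exists_optimalLRC (D := 2 * u + 1) (s := 0) hK (hprod n h1 h2) (by omega)
        (by omega) (by omega)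
    -- This is `D + 2 * s ≤ Q + 1` for `D = 2 * u + 1` and `s = u - v`.
    · have huv : 4 * (u : ℤ) + 1 - (p ^ h : ℕ) ≤ 2 * v + 1 := by
        push_cast
        exact (le_max_right _ _).trans huv
      exact LRC.exists_optimalLRC (D := 2 * u + 1) (s := u - v) hK (hprod n (by simp) h2)
        (by omega) (by omega) (by omega)
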